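/- Let $k$ be a field and let $(C,\Delta,\varepsilon)$ be a coalgebra over $k$ (coassociative and counital, of arbitrary dimension). Let $C^*=\operatorname{Hom}_k(C,k)$ be its dual algebra, with product $(f*g)(c)=\sum f(c_1)g(c_2)$ and unit $\varepsilon$, where $\Delta(c)=\sum c_1\otimes c_2$, and regard $C$ as a right $C^*$-module through $c\cdot f=\sum f(c_1)c_2$. The coalgebra $C$ is called right co-Frobenius if there is an injective morphism of right $C^*$-modules $C\to C^*$, and right quasi-co-Frobenius if there is an injective morphism of right $C^*$-modules from $C$ to a free right $C^*$-module. A left coideal of $C$ is a subspace $I$ with $\Delta(I)\subseteq C\otimes I$, i.e. a left subcomodule of $C$. The coalgebra $C$ is called basic if its coradical (the sum of its simple subcoalgebras) is a direct sum of simple left coideals that are pairwise non-isomorphic as left $C$-comodules. Proposition. If $C$ is right quasi-co-Frobenius and basic, then $C$ is right co-Frobenius. -/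

import Mathlib

open scoped TensorProduct

universe u v

namespace CoalgQcF

noncomputable section

variable (k : Type u) (C : Type v) [Field k] [AddCommGroup C] [Module k C] [Coalgebra k C]

/-- The dual algebra `C^*`: linear forms on `C` with the convolution product
`(f * g)(c) = ∑ f(c₁) g(c₂)`, with unit the counit. -/
abbrev DualAlg : Type (max u v) := WithConv (C →ₗ[k] k)

variable {k C}

/-- The right action of the dual algebra on `C`: `c · f = ∑ f(c₁) c₂`. -/
def rightAct (f : DualAlg k C) : C →ₗ[k] C :=
  (TensorProduct.lid k C).toLinearMap ∘ₗ LinearMap.rTensor C f.ofConv ∘ₗ Coalgebra.comul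

theorem rightAct_repr (f : DualAlg k C) {ι : Type*} {c : C} (r : Coalgebra.Repr k c ι) :
    rightAct f c = ∑ i ∈ r.index, f (r.left i) • r.right i := by
  simp only [rightAct, LinearMap.comp_apply, ← r.eq, map_sum, LinearMap.rTensor_tmul,
    LinearEquiv.coe_coe, TensorProduct.lid_tmul]

theorem rightAct_one (c : C) : rightAct (1 : DualAlg k C) c = c := by
  have h : (1 : DualAlg k C).ofConv = Coalgebra.counit := by
    ext x
    simp [LinearMap.convOne_def]
  simp [rightAct, h]

theorem rightAct_add (f g : DualAlg k C) (c : C) :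
    rightAct (f + g) c = rightAct f c + rightAct g c := by
  simp [rightAct, LinearMap.rTensor_add]

theorem rightAct_zero (c : C) : rightAct (0 : DualAlg k C) c = 0 := by
  simp [rightAct]

theorem rightAct_mul (f g : DualAlg k C) (c : C) :
    rightAct (f * g) c = rightAct g (rightAct f c) := by
  have key : ∀ t : C ⊗[k] (C ⊗[k] C),
      TensorProduct.lid k C (LinearMap.rTensor C
        (LinearMap.mul' k k ∘ₗ TensorProduct.map f.ofConv g.ofConv)
          ((TensorProduct.assoc k C C C).symm t)) =
      TensorProduct.lid k C (LinearMap.rTensor C g.ofConv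
        (TensorProduct.lid k (C ⊗[k] C) (LinearMap.rTensor (C ⊗[k] C) f.ofConv t))) := by
    intro t
    induction t using TensorProduct.induction_on with
    | zero => simp
    | add x y hx hy => simp only [map_add, hx, hy]
    | tmul a y =>
      induction y using TensorProduct.induction_on with
      | zero => simp
      | add x y hx hy => simp only [TensorProduct.tmul_add, map_add, hx, hy]
      | tmul b d => simp [mul_smul]
  have nat : ∀ t : C ⊗[k] C,
      Coalgebra.comul (R := k) (TensorProduct.lid k C (LinearMap.rTensor C f.ofConv t)) =
      TensorProduct.lid k (C ⊗[k] C) (LinearMap.rTensor (C ⊗[k] C) f.ofConv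
        (LinearMap.lTensor C Coalgebra.comul t)) := by
    intro t
    induction t using TensorProduct.induction_on with
    | zero => simp
    | add x y hx hy => simp only [map_add, hx, hy]
    | tmul a y => simp
  have h := key (LinearMap.lTensor C Coalgebra.comul (Coalgebra.comul (R := k) c))
  rw [Coalgebra.coassoc_symm_apply, ← nat] at h
  simp only [rightAct, LinearMap.comp_apply, LinearEquiv.coe_coe]
  rw [← h, ← LinearMap.rTensor_comp_apply]
  rfl

/-- `C` as a right module over its dual algebra, with `c · f = ∑ f(c₁) c₂`; right modules are
modules over the opposite algebra. -/
instance dualAlgRightModule : Module (DualAlg k C)ᵐᵒᵖ C where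
  smul f c := rightAct f.unop c
  one_smul c := rightAct_one c
  mul_smul f g c := rightAct_mul g.unop f.unop c
  smul_zero f := map_zero (rightAct f.unop)
  smul_add f := map_add (rightAct f.unop)
  add_smul f g c := rightAct_add f.unop g.unop c
  zero_smul c := rightAct_zero c

theorem op_smul_def (f : DualAlg k C) (c : C) : MulOpposite.op f • c = rightAct f c := rfl

variable (k C)

/-- `C` embeds in `C^*` as a right `C^*`-module. -/
def IsRightCoFrobenius : Prop :=
  ∃ φ : C →ₗ[(DualAlg k C)ᵐᵒᵖ] DualAlg k C, Function.Injective φ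

/-- `C` embeds, as a right `C^*`-module, in some free right `C^*`-module.  (The universe of `F`
is no restriction: a submodule isomorphic to `C` lies in a free summand on at most `|C × ℕ|`
basis vectors, and `C^*` and `C` live in the universe of `F`.) -/
def IsRightQuasiCoFrobenius : Prop :=
  ∃ (F : Type (max u v)) (_ : AddCommGroup F) (_ : Module (DualAlg k C)ᵐᵒᵖ F)
    (_ : Module.Free (DualAlg k C)ᵐᵒᵖ F) (φ : C →ₗ[(DualAlg k C)ᵐᵒᵖ] F), Function.Injective φ

variable {C}

/-- `Δ(D) ⊆ D ⊗ D`. -/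
def IsSubcoalgebra (D : Submodule k C) : Prop :=
  ∀ c ∈ D, Coalgebra.comul (R := k) c ∈ LinearMap.range (TensorProduct.map D.subtype D.subtype)

/-- A nonzero subcoalgebra whose only subcoalgebras are zero and itself. -/
def IsSimpleSubcoalgebra (D : Submodule k C) : Prop :=
  IsSubcoalgebra k D ∧ D ≠ ⊥ ∧ ∀ D' ≤ D, IsSubcoalgebra k D' → D' = ⊥ ∨ D' = D

variable (C) in
/-- The coradical: the sum of all simple subcoalgebras. -/
def coradical : Submodule k C := sSup {D | IsSimpleSubcoalgebra k D}

/-- `Δ(I) ⊆ C ⊗ I`, i.e. `I` is a left subcomodule of `C`. -/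
def IsLeftCoideal (I : Submodule k C) : Prop :=
  ∀ c ∈ I, Coalgebra.comul (R := k) c ∈ LinearMap.range (LinearMap.lTensor C I.subtype)

/-- A left coideal that is a simple left comodule. -/
def IsSimpleLeftCoideal (I : Submodule k C) : Prop :=
  IsLeftCoideal k I ∧ I ≠ ⊥ ∧ ∀ J ≤ I, IsLeftCoideal k J → J = ⊥ ∨ J = I

variable {k}

theorem lTensor_subtype_injective (I : Submodule k C) :
    Function.Injective (LinearMap.lTensor C I.subtype) :=
  Module.Flat.lTensor_preserves_injective_linearMap _ I.injective_subtype

/-- The left comodule structure `I → C ⊗ I` of a left coideal `I`: the restriction of `Δ`. -/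
def leftCoaction {I : Submodule k C} (hI : IsLeftCoideal k I) : I →ₗ[k] C ⊗[k] I :=
  (LinearEquiv.ofInjective _ (lTensor_subtype_injective I)).symm.toLinearMap ∘ₗ
    (Coalgebra.comul (R := k) (A := C) ∘ₗ I.subtype).codRestrict
      (LinearMap.range (LinearMap.lTensor C I.subtype)) (fun x => hI x x.2)

theorem lTensor_subtype_leftCoaction {I : Submodule k C} (hI : IsLeftCoideal k I) (x : I) :
    LinearMap.lTensor C I.subtype (leftCoaction hI x) = Coalgebra.comul (R := k) (x : C) := by
  have h := LinearEquiv.apply_symm_apply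
    (LinearEquiv.ofInjective _ (lTensor_subtype_injective I))
    (((Coalgebra.comul (R := k) (A := C) ∘ₗ I.subtype).codRestrict
      (LinearMap.range (LinearMap.lTensor C I.subtype)) (fun x => hI x x.2)) x)
  exact congrArg Subtype.val h

/-- Isomorphism of two left coideals as left `C`-comodules. -/
def LeftComoduleIso {I J : Submodule k C} (hI : IsLeftCoideal k I) (hJ : IsLeftCoideal k J) :
    Prop :=
  ∃ e : I ≃ₗ[k] J, ∀ x : I,
    leftCoaction hJ (e x) = LinearMap.lTensor C e.toLinearMap (leftCoaction hI x)

variable (k C)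

/-- The coradical is the (internal) direct sum of a family of pairwise non-isomorphic simple left
coideals.  (Such a family is injective, hence can be indexed by a type in the universe of `C`.) -/
def IsBasic : Prop :=
  ∃ (ι : Type v) (S : ι → Submodule k C) (hS : ∀ i, IsSimpleLeftCoideal k (S i)),
    iSupIndep S ∧ ⨆ i, S i = coradical k C ∧
      Pairwise fun i j => ¬ LeftComoduleIso (hS i).1 (hS j).1

end

end CoalgQcF

/-! Left multiplication by a linear form commutes with the right action, so it is a right linear
endomorphism of `C`. Since the coradical is the direct sum of the simple coideals `S i`, there are
forms `g i` acting from the left as the identity on `S i` and as zero on the other summands, with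
only finitely many nonzero on each element (`exists_projections`). A coordinate of the embedding
into a free module gives `φ i : C → C^*` that is nonzero on `S i`
(`IsRightQuasiCoFrobenius.exists_ne_zero`). The locally finite sum of the `φ i ∘ (g i · -)` agrees
with `φ i` on `S i`.

Being nonzero on each `S i` suffices for injectivity (`injective_of_forall_ne_zero`): a nonzero
kernel contains a simple submodule by local finiteness; it lies in the coradical (`le_coradical`),
hence is some `S i`, because the summands are pairwise non-isomorphic (`exists_le_of_le_iSup`). -/

namespace CoalgQcF

/-! ### The two commuting actions of the dual algebra -/

section Actions

variable {k : Type u} {C : Type v} [Field k] [AddCommGroup C] [Module k C] [Coalgebra k C]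

/-- An element of `C ⊗ V` is zero as soon as all `f ⊗ id` kill it. -/
theorem tensor_eq_zero_of_forall_left {V W : Type*} [AddCommGroup V] [Module k V]
    [AddCommGroup W] [Module k W] (x : V ⊗[k] W)
    (h : ∀ f : V →ₗ[k] k, TensorProduct.lid k W (LinearMap.rTensor W f x) = 0) : x = 0 := by
  classical
  let b := Module.Basis.ofVectorSpace k V
  apply (TensorProduct.equivFinsuppOfBasisLeft (N := W) b).injective
  ext i
  have key : ∀ y : V ⊗[k] W, TensorProduct.equivFinsuppOfBasisLeft b y i =
      TensorProduct.lid k W (LinearMap.rTensor W (b.coord i) y) := by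
    intro y
    induction y using TensorProduct.induction_on with
    | zero => simp
    | add x y hx hy => simp only [map_add, Finsupp.add_apply, hx, hy]
    | tmul a c => simp
  rw [key, h, map_zero, Finsupp.zero_apply]

theorem tensor_eq_zero_of_forall_right {V W : Type*} [AddCommGroup V] [Module k V]
    [AddCommGroup W] [Module k W] (x : V ⊗[k] W)
    (h : ∀ f : W →ₗ[k] k, TensorProduct.rid k V (LinearMap.lTensor V f x) = 0) : x = 0 := by
  apply (TensorProduct.comm k V W).injective
  rw [map_zero]
  refine tensor_eq_zero_of_forall_left _ fun f => ?_
  rw [← h f]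
  generalize x = y
  induction y using TensorProduct.induction_on with
  | zero => simp
  | add x y hx hy => simp only [map_add, hx, hy]
  | tmul a c => simp

/-- The left action of the dual algebra on `C`: `g · c = ∑ g(c₂) c₁`. -/
noncomputable def leftAct (g : DualAlg k C) : C →ₗ[k] C :=
  (TensorProduct.rid k C).toLinearMap ∘ₗ LinearMap.lTensor C g.ofConv ∘ₗ Coalgebra.comul

theorem leftAct_repr (g : DualAlg k C) {ι : Type*} {c : C} (r : Coalgebra.Repr k c ι) :
    leftAct g c = ∑ i ∈ r.index, g (r.right i) • r.left i := by
  simp only [leftAct, LinearMap.comp_apply, ← r.eq, map_sum, LinearMap.lTensor_tmul,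
    LinearEquiv.coe_coe, TensorProduct.rid_tmul]

theorem mul_apply_eq_rightAct (f g : DualAlg k C) (c : C) : (f * g) c = g (rightAct f c) := by
  let r := Coalgebra.Repr.arbitrary k c
  rw [rightAct_repr f r, r.convMul_apply, map_sum]
  simp

theorem mul_apply_eq_leftAct (f g : DualAlg k C) (c : C) : (f * g) c = f (leftAct g c) := by
  let r := Coalgebra.Repr.arbitrary k c
  rw [leftAct_repr g r, r.convMul_apply, map_sum]
  simp [mul_comm]

-- Tested against forms, identities between actions reduce to the axioms of the convolution algebra.
omit [Coalgebra k C] in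
theorem eq_of_forall_dual {x y : C} (h : ∀ f : DualAlg k C, f x = f y) : x = y := by
  rw [← sub_eq_zero, ← Module.forall_dual_apply_eq_zero_iff k]
  intro f
  rw [map_sub, sub_eq_zero]
  exact h (WithConv.toConv f)

theorem counit_rightAct (f : DualAlg k C) (c : C) :
    Coalgebra.counit (R := k) (rightAct f c) = f c := by
  have h := mul_apply_eq_rightAct f 1 c
  rw [mul_one] at h
  rw [h]
  simp [LinearMap.convOne_def]

theorem leftAct_one (c : C) : leftAct (1 : DualAlg k C) c = c :=
  eq_of_forall_dual fun f => by rw [← mul_apply_eq_leftAct, mul_one]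

theorem leftAct_mul (f g : DualAlg k C) (c : C) :
    leftAct (f * g) c = leftAct f (leftAct g c) :=
  eq_of_forall_dual fun h => by
    rw [← mul_apply_eq_leftAct, ← mul_assoc, mul_apply_eq_leftAct, mul_apply_eq_leftAct]

theorem leftAct_rightAct (f g : DualAlg k C) (c : C) :
    leftAct g (rightAct f c) = rightAct f (leftAct g c) :=
  eq_of_forall_dual fun h => by
    rw [← mul_apply_eq_leftAct, ← mul_apply_eq_rightAct, ← mul_apply_eq_rightAct,
      ← mul_apply_eq_leftAct, mul_assoc]

/-- The left action of the dual algebra commutes with the right one. -/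
noncomputable def leftActHom (g : DualAlg k C) : C →ₗ[(DualAlg k C)ᵐᵒᵖ] C where
  toFun := leftAct g
  map_add' := map_add _
  map_smul' f c := leftAct_rightAct f.unop g c

@[simp]
theorem leftActHom_apply (g : DualAlg k C) (c : C) : leftActHom g c = leftAct g c := rfl

instance : IsScalarTower k (DualAlg k C)ᵐᵒᵖ C where
  smul_assoc a f c := by
    change rightAct (a • f).unop c = a • rightAct f.unop c
    simp [rightAct, LinearMap.rTensor_smul]

end Actions

/-! ### Coideals and subcoalgebras as submodules -/

section Coideals

variable {k : Type u} {C : Type v} [Field k] [AddCommGroup C] [Module k C] [Coalgebra k C]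

theorem lid_rTensor_lTensor {V W X : Type*} [AddCommGroup V] [Module k V] [AddCommGroup W]
    [Module k W] [AddCommGroup X] [Module k X] (f : V →ₗ[k] k) (e : W →ₗ[k] X) (y : V ⊗[k] W) :
    TensorProduct.lid k X (LinearMap.rTensor X f (LinearMap.lTensor V e y)) =
      e (TensorProduct.lid k W (LinearMap.rTensor W f y)) := by
  induction y using TensorProduct.induction_on with
  | zero => simp
  | add x y hx hy => simp only [map_add, hx, hy]
  | tmul a c => simp

theorem rid_lTensor_rTensor {V W X : Type*} [AddCommGroup V] [Module k V] [AddCommGroup W]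
    [Module k W] [AddCommGroup X] [Module k X] (f : W →ₗ[k] k) (e : V →ₗ[k] X) (y : V ⊗[k] W) :
    TensorProduct.rid k X (LinearMap.lTensor X f (LinearMap.rTensor W e y)) =
      e (TensorProduct.rid k V (LinearMap.lTensor V f y)) := by
  induction y using TensorProduct.induction_on with
  | zero => simp
  | add x y hx hy => simp only [map_add, hx, hy]
  | tmul a c => simp

theorem rightAct_coe {I : Submodule k C} (hI : IsLeftCoideal k I) (f : DualAlg k C) (x : I) :
    rightAct f (x : C) =
      (TensorProduct.lid k I (LinearMap.rTensor I f.ofConv (leftCoaction hI x)) : I) := by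
  change _ = I.subtype _
  rw [← lid_rTensor_lTensor, lTensor_subtype_leftCoaction]
  rfl

theorem IsLeftCoideal.rightAct_mem {I : Submodule k C} (hI : IsLeftCoideal k I)
    (f : DualAlg k C) {x : C} (hx : x ∈ I) : rightAct f x ∈ I := by
  rw [rightAct_coe hI f ⟨x, hx⟩]
  exact Subtype.property _

/-- By right exactness, `C ⊗ I` has as image in `C ⊗ C` the kernel of the map to `C ⊗ C/I`, and
vanishing there is tested by forms on the left factor. -/
theorem isLeftCoideal_of_rightAct_mem {I : Submodule k C}
    (h : ∀ (f : DualAlg k C), ∀ x ∈ I, rightAct f x ∈ I) : IsLeftCoideal k I := by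
  intro c hc
  have hex := lTensor_exact C (LinearMap.exact_subtype_mkQ I) I.mkQ_surjective
  refine (hex _).1 (tensor_eq_zero_of_forall_left _ fun f => ?_)
  rw [lid_rTensor_lTensor]
  exact (Submodule.Quotient.mk_eq_zero I).2 (h (WithConv.toConv f) c hc)

/-- A left coideal as a right submodule over the dual algebra. -/
def IsLeftCoideal.toSubmodule {I : Submodule k C} (hI : IsLeftCoideal k I) :
    Submodule (DualAlg k C)ᵐᵒᵖ C where
  carrier := I
  add_mem' := I.add_mem
  zero_mem' := I.zero_mem
  smul_mem' f _ hx := hI.rightAct_mem f.unop hx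

theorem isLeftCoideal_restrictScalars (N : Submodule (DualAlg k C)ᵐᵒᵖ C) :
    IsLeftCoideal k (N.restrictScalars k) :=
  isLeftCoideal_of_rightAct_mem fun f _ hx => N.smul_mem (MulOpposite.op f) hx

theorem IsSimpleLeftCoideal.isSimpleModule {I : Submodule k C} (hI : IsSimpleLeftCoideal k I) :
    IsSimpleModule (DualAlg k C)ᵐᵒᵖ hI.1.toSubmodule := by
  rw [isSimpleModule_iff_isAtom]
  refine ⟨fun h => hI.2.1 ?_, fun N hN => ?_⟩
  · rw [Submodule.eq_bot_iff] at h ⊢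
    exact h
  · rcases hI.2.2 (N.restrictScalars k) hN.le (isLeftCoideal_restrictScalars N) with h | h
    · rwa [Submodule.restrictScalars_eq_bot_iff] at h
    · exact absurd (fun x hx => (h ▸ hx : x ∈ N.restrictScalars k)) hN.not_ge

theorem leftComoduleIso_of_linearEquiv {I J : Submodule k C} (hI : IsLeftCoideal k I)
    (hJ : IsLeftCoideal k J)
    (e : hI.toSubmodule ≃ₗ[(DualAlg k C)ᵐᵒᵖ] hJ.toSubmodule) : LeftComoduleIso hI hJ := by
  let e' : I ≃ₗ[k] J := e.restrictScalars k
  refine ⟨e', fun x => ?_⟩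
  rw [← sub_eq_zero]
  refine tensor_eq_zero_of_forall_left _ fun f => ?_
  rw [map_sub, map_sub, sub_eq_zero, lid_rTensor_lTensor]
  apply Subtype.ext
  refine (rightAct_coe hJ (WithConv.toConv f) (e' x)).symm.trans ?_
  have h := congrArg Subtype.val (e.map_smul (MulOpposite.op (WithConv.toConv f)) x)
  refine h.symm.trans (congrArg (fun y => (e' y : C)) (Subtype.ext ?_))
  exact rightAct_coe hI (WithConv.toConv f) x

theorem IsSubcoalgebra.isLeftCoideal {D : Submodule k C} (hD : IsSubcoalgebra k D) :
    IsLeftCoideal k D := by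
  intro c hc
  obtain ⟨y, hy⟩ := hD c hc
  refine ⟨LinearMap.rTensor D D.subtype y, ?_⟩
  rw [← hy, ← LinearMap.comp_apply, LinearMap.lTensor_comp_rTensor]

theorem IsSubcoalgebra.leftAct_mem {D : Submodule k C} (hD : IsSubcoalgebra k D)
    (g : DualAlg k C) {x : C} (hx : x ∈ D) : leftAct g x ∈ D := by
  obtain ⟨y, hy⟩ := hD x hx
  have h : leftAct g x = D.subtype (TensorProduct.rid k D (LinearMap.lTensor D g.ofConv
      (LinearMap.lTensor D D.subtype y))) := by
    rw [← rid_lTensor_rTensor, ← LinearMap.comp_apply (LinearMap.rTensor C D.subtype),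
      LinearMap.rTensor_comp_lTensor, hy]
    rfl
  rw [h]
  exact Subtype.property _

/-- For a linear projection `q` onto `D`, each one-sided stability says that `q` on one tensor
factor fixes `Δ c`; together, `q ⊗ q` fixes it. -/
theorem isSubcoalgebra_of_mem {D : Submodule k C}
    (hr : ∀ (f : DualAlg k C), ∀ x ∈ D, rightAct f x ∈ D)
    (hl : ∀ (f : DualAlg k C), ∀ x ∈ D, leftAct f x ∈ D) : IsSubcoalgebra k D := by
  intro c hc
  obtain ⟨p, hp⟩ := D.subtype.exists_leftInverse_of_injective D.ker_subtype
  have hp' : ∀ x ∈ D, (p x : C) = x := fun x hx =>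
    congrArg Subtype.val (LinearMap.congr_fun hp ⟨x, hx⟩)
  set q : C →ₗ[k] C := D.subtype ∘ₗ p with hq
  have h1 : LinearMap.lTensor C q (Coalgebra.comul (R := k) c) = Coalgebra.comul (R := k) c := by
    rw [← sub_eq_zero]
    refine tensor_eq_zero_of_forall_left _ fun f => ?_
    rw [map_sub, map_sub, lid_rTensor_lTensor, sub_eq_zero]
    exact hp' _ (hr (WithConv.toConv f) c hc)
  have h2 : LinearMap.rTensor C q (Coalgebra.comul (R := k) c) = Coalgebra.comul (R := k) c := by
    rw [← sub_eq_zero]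
    refine tensor_eq_zero_of_forall_right _ fun f => ?_
    rw [map_sub, map_sub, rid_lTensor_rTensor, sub_eq_zero]
    exact hp' _ (hl (WithConv.toConv f) c hc)
  refine ⟨TensorProduct.map p p (Coalgebra.comul (R := k) c), ?_⟩
  rw [← LinearMap.comp_apply, ← TensorProduct.map_comp, ← hq,
    ← LinearMap.rTensor_comp_lTensor, LinearMap.comp_apply, h1, h2]

end Coideals

/-! ### Local finiteness, and simple submodules inside the coradical -/

section Simple

variable {k : Type u} {C : Type v} [Field k] [AddCommGroup C] [Module k C] [Coalgebra k C]

/-- Every `c · f` lies in the span of the finitely many right tensor factors of one expression for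
`Δ c`. -/
theorem finite_span_singleton (c : C) :
    Module.Finite k (Submodule.span (DualAlg k C)ᵐᵒᵖ {c}) := by
  let r := Coalgebra.Repr.arbitrary k c
  let V : Submodule k C := Submodule.span k (r.right '' (r.index : Set _))
  have hV : (Submodule.span (DualAlg k C)ᵐᵒᵖ {c}).restrictScalars k ≤ V := by
    intro x hx
    rw [Submodule.restrictScalars_mem, Submodule.mem_span_singleton] at hx
    obtain ⟨f, rfl⟩ := hx
    change rightAct f.unop c ∈ V
    rw [rightAct_repr _ r]
    exact V.sum_mem fun i hi => V.smul_mem _ (Submodule.subset_span ⟨i, hi, rfl⟩)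
  have : Module.Finite k V :=
    Module.Finite.span_of_finite k ((r.index.finite_toSet).image _)
  exact Submodule.finiteDimensional_of_le hV

theorem exists_isSimpleModule_le_of_isArtinian {R M : Type*} [Ring R] [AddCommGroup M]
    [Module R M] {N : Submodule R M} [IsArtinian R N] (hN : N ≠ ⊥) :
    ∃ T ≤ N, IsSimpleModule R T := by
  have : Nontrivial N := Submodule.nontrivial_iff_ne_bot.2 hN
  obtain ⟨T, hT⟩ := IsAtomic.exists_atom (Submodule R N)
  rw [← isSimpleModule_iff_isAtom] at hT
  exact ⟨T.map N.subtype, Submodule.map_subtype_le _ _,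
    IsSimpleModule.congr (T.equivMapOfInjective _ N.subtype_injective).symm⟩

/-- Every nonzero right submodule of `C` contains a simple one. -/
theorem exists_isSimpleModule_le {N : Submodule (DualAlg k C)ᵐᵒᵖ C} (hN : N ≠ ⊥) :
    ∃ T ≤ N, IsSimpleModule (DualAlg k C)ᵐᵒᵖ T := by
  obtain ⟨c, hc, hc0⟩ := N.exists_mem_ne_zero_of_ne_bot hN
  let P := Submodule.span (DualAlg k C)ᵐᵒᵖ {c}
  have : Module.Finite k P := finite_span_singleton c
  have : IsArtinian (DualAlg k C)ᵐᵒᵖ P := 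
    isArtinian_of_tower k (isArtinian_of_fg_of_artinian' (R := k) (M := P))
  obtain ⟨T, hT, hs⟩ := exists_isSimpleModule_le_of_isArtinian (R := (DualAlg k C)ᵐᵒᵖ)
    (N := P) (by simpa [P] using hc0)
  exact ⟨T, hT.trans (by simpa [P] using hc), hs⟩

/-- Right linear maps into `C` are given by the left action of a linear form. -/
theorem exists_leftAct_eq {N : Submodule (DualAlg k C)ᵐᵒᵖ C}
    (h : N →ₗ[(DualAlg k C)ᵐᵒᵖ] C) : ∃ g : DualAlg k C, ∀ x : N, h x = leftAct g x := by
  -- By `counit_rightAct`, `h` is determined by `ε ∘ h`; any linear extension of that form to `C`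
  -- serves.
  obtain ⟨g, hg⟩ := LinearMap.exists_extend (p := N.restrictScalars k)
    (Coalgebra.counit (R := k) (A := C) ∘ₗ h.restrictScalars k)
  refine ⟨WithConv.toConv g, fun x => eq_of_forall_dual (k := k) fun f => ?_⟩
  rw [← mul_apply_eq_leftAct, mul_apply_eq_rightAct, ← counit_rightAct f (h x)]
  have h1 : rightAct f (h x) = h (MulOpposite.op f • x) :=
    (h.map_smul (MulOpposite.op f) x).symm
  rw [h1]
  exact (LinearMap.congr_fun hg (MulOpposite.op f • x)).symm

/-- The subcoalgebra generated by a right submodule. -/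
noncomputable def generatedSubcoalgebra (T : Submodule (DualAlg k C)ᵐᵒᵖ C) :
    Submodule (DualAlg k C)ᵐᵒᵖ C :=
  ⨆ g : DualAlg k C, T.map (leftActHom g)

theorem leftAct_mem_generatedSubcoalgebra {T : Submodule (DualAlg k C)ᵐᵒᵖ C}
    (g : DualAlg k C) {x : C} (hx : x ∈ T) : leftAct g x ∈ generatedSubcoalgebra T :=
  Submodule.mem_iSup_of_mem g ⟨x, hx, rfl⟩

theorem le_generatedSubcoalgebra (T : Submodule (DualAlg k C)ᵐᵒᵖ C) :
    T ≤ generatedSubcoalgebra T := fun x hx => by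
  simpa only [leftAct_one] using leftAct_mem_generatedSubcoalgebra 1 hx

theorem isSubcoalgebra_generatedSubcoalgebra (T : Submodule (DualAlg k C)ᵐᵒᵖ C) :
    IsSubcoalgebra k ((generatedSubcoalgebra T).restrictScalars k) := by
  refine isSubcoalgebra_of_mem
    (fun f x hx => (generatedSubcoalgebra T).smul_mem (MulOpposite.op f) hx) fun f x hx => ?_
  have h : generatedSubcoalgebra T ≤ (generatedSubcoalgebra T).comap (leftActHom f) := by
    refine iSup_le fun g => ?_
    rintro _ ⟨t, ht, rfl⟩
    rw [Submodule.mem_comap, leftActHom_apply, leftActHom_apply, ← leftAct_mul]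
    exact leftAct_mem_generatedSubcoalgebra _ ht
  exact h hx

/-- Each left translate of the simple `T` is a right linear image of it, hence zero or a copy of
`T`. -/
theorem generatedSubcoalgebra_le_isotypicComponent (T : Submodule (DualAlg k C)ᵐᵒᵖ C)
    [IsSimpleModule (DualAlg k C)ᵐᵒᵖ T] :
    generatedSubcoalgebra T ≤ isotypicComponent (DualAlg k C)ᵐᵒᵖ C T := by
  refine iSup_le fun g => ?_
  rcases LinearMap.injective_or_eq_zero (R := (DualAlg k C)ᵐᵒᵖ) (M := T) (N := C)
      ((leftActHom g).domRestrict T) with h | h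
  · refine le_sSup ⟨?_⟩
    refine LinearEquiv.symm ((LinearEquiv.ofInjective _ h).trans (LinearEquiv.ofEq _ _ ?_))
    rw [LinearMap.range_domRestrict]
  · rintro _ ⟨t, ht, rfl⟩
    have := LinearMap.congr_fun h ⟨t, ht⟩
    rw [LinearMap.domRestrict_apply] at this
    rw [this]
    exact Submodule.zero_mem _

/-- A nonzero subcoalgebra `D` inside contains a simple `T'`, isomorphic to `T` by isotypicity. The
isomorphism is the left action of a form, which preserves `D`, so `T ≤ D` and `D` is everything. -/
theorem isSimpleSubcoalgebra_generatedSubcoalgebra (T : Submodule (DualAlg k C)ᵐᵒᵖ C)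
    [IsSimpleModule (DualAlg k C)ᵐᵒᵖ T] :
    IsSimpleSubcoalgebra k ((generatedSubcoalgebra T).restrictScalars k) := by
  refine ⟨isSubcoalgebra_generatedSubcoalgebra T, fun h => ?_, fun D hD hsub => ?_⟩
  · rw [Submodule.restrictScalars_eq_bot_iff] at h
    have h2 := (isSimpleModule_iff_isAtom.1 ‹IsSimpleModule _ T›).1
    exact h2 (le_bot_iff.1 (h ▸ le_generatedSubcoalgebra T))
  rw [or_iff_not_imp_left]
  intro hne
  have hDne : hsub.isLeftCoideal.toSubmodule ≠ ⊥ := fun h => hne <| by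
    rw [Submodule.eq_bot_iff] at h ⊢
    exact h
  obtain ⟨T', hT', hs⟩ := exists_isSimpleModule_le hDne
  have hle : T' ≤ isotypicComponent (DualAlg k C)ᵐᵒᵖ C T :=
    fun x hx => generatedSubcoalgebra_le_isotypicComponent T (hD (hT' hx))
  have : ∀ m : {m : Submodule (DualAlg k C)ᵐᵒᵖ C | Nonempty (m ≃ₗ[(DualAlg k C)ᵐᵒᵖ] T)},
      IsSimpleModule (DualAlg k C)ᵐᵒᵖ m := fun m => IsSimpleModule.congr (R := (DualAlg k C)ᵐᵒᵖ) (N := T) m.2.some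
  obtain ⟨S, ⟨eS⟩, ⟨e⟩⟩ := T'.linearEquiv_of_le_sSup _ hle
  obtain ⟨g, hg⟩ := exists_leftAct_eq (T.subtype ∘ₗ (e.trans eS).toLinearMap)
  have hTD : ∀ t ∈ T, t ∈ D := fun t ht => by
    have h := hg ((e.trans eS).symm ⟨t, ht⟩)
    rw [LinearMap.comp_apply, LinearEquiv.coe_coe, LinearEquiv.apply_symm_apply,
      Submodule.subtype_apply] at h
    rw [show t = _ from h]
    exact hsub.leftAct_mem g (hT' (Subtype.property _))
  refine le_antisymm hD fun x hx => ?_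
  have hle : generatedSubcoalgebra T ≤ hsub.isLeftCoideal.toSubmodule := by
    refine iSup_le fun g => ?_
    rintro _ ⟨t, ht, rfl⟩
    exact hsub.leftAct_mem g (hTD t ht)
  exact hle hx

theorem le_coradical (T : Submodule (DualAlg k C)ᵐᵒᵖ C) [IsSimpleModule (DualAlg k C)ᵐᵒᵖ T] :
    T.restrictScalars k ≤ coradical k C :=
  le_trans (fun _ hx => le_generatedSubcoalgebra T hx)
    (le_sSup (isSimpleSubcoalgebra_generatedSubcoalgebra T))

end Simple

/-! ### Projections onto the simple coideals, and the embedding -/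

section Main

variable {k : Type u} {C : Type v} [Field k] [AddCommGroup C] [Module k C] [Coalgebra k C]

/-- Only the values of `g` on `I` matter: `f (g · x) = g (x · f)`, and `x · f` stays in `I`. -/
theorem leftAct_eq_self {I : Submodule k C} (hI : IsLeftCoideal k I) {g : DualAlg k C}
    (hg : ∀ x ∈ I, g x = Coalgebra.counit (R := k) x) {x : C} (hx : x ∈ I) :
    leftAct g x = x :=
  eq_of_forall_dual fun f => by
    rw [← mul_apply_eq_leftAct, mul_apply_eq_rightAct, hg _ (hI.rightAct_mem f hx),
      counit_rightAct]

theorem leftAct_eq_zero {I : Submodule k C} (hI : IsLeftCoideal k I) {g : DualAlg k C}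
    (hg : ∀ x ∈ I, g x = 0) {x : C} (hx : x ∈ I) : leftAct g x = 0 :=
  eq_of_forall_dual fun f => by
    rw [← mul_apply_eq_leftAct, mul_apply_eq_rightAct, hg _ (hI.rightAct_mem f hx), map_zero]

/-- Linear forms projecting onto the members of an independent family of left coideals. -/
theorem exists_projections {ι : Type*} {S : ι → Submodule k C}
    (hS : ∀ i, IsLeftCoideal k (S i)) (hind : iSupIndep S) :
    ∃ g : ι → DualAlg k C, (∀ i, ∀ x ∈ S i, leftAct (g i) x = x) ∧
      (∀ i j, i ≠ j → ∀ x ∈ S j, leftAct (g i) x = 0) ∧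
      ∀ c, {i | leftAct (g i) c ≠ 0}.Finite := by
  classical
  have hinj := (iSupIndep_iff_dfinsupp_lsum_injective S).1 hind
  -- `L` retracts `C` linearly onto the direct sum. Its values have finite support, which makes the
  -- forms `ε ∘ (L · i)` locally finite.
  obtain ⟨L, hL⟩ := (DFinsupp.lsum (R := k) ℕ fun i => (S i).subtype).exists_leftInverse_of_injective
    (LinearMap.ker_eq_bot.2 hinj)
  have hLs : ∀ i (x : S i), L x = DFinsupp.single i x := fun i x => by
    simpa using LinearMap.congr_fun hL (DFinsupp.single i x)
  let g : ι → DualAlg k C := fun i => WithConv.toConv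
    (Coalgebra.counit (R := k) ∘ₗ (S i).subtype ∘ₗ DFinsupp.lapply i ∘ₗ L)
  have hg : ∀ i c, g i c = Coalgebra.counit (R := k) (L c i : C) := fun _ _ => rfl
  refine ⟨g, fun i x hx => leftAct_eq_self (hS i) (fun y hy => ?_) hx,
    fun i j hij x hx => leftAct_eq_zero (hS j) (fun y hy => ?_) hx, fun c => ?_⟩
  · rw [hg, hLs i ⟨y, hy⟩, DFinsupp.single_eq_same]
  · rw [hg, hLs j ⟨y, hy⟩, DFinsupp.single_eq_of_ne hij, Submodule.coe_zero, map_zero]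
  · let r := Coalgebra.Repr.arbitrary k c
    refine (r.index.finite_toSet.biUnion fun a _ =>
      (L (r.right a)).support.finite_toSet).subset fun i hi => ?_
    rw [Set.mem_ofPred_eq, leftAct_repr _ r] at hi
    obtain ⟨a, ha, hne⟩ := Finset.exists_ne_zero_of_sum_ne_zero hi
    refine Set.mem_biUnion ha ?_
    rw [Finset.mem_coe, DFinsupp.mem_support_iff]
    intro h0
    rw [hg, h0, Submodule.coe_zero, map_zero, zero_smul] at hne
    exact hne rfl

/-- A simple right submodule of the sum of a family of pairwise non-isomorphic simple left coideals
is contained in a member of the family. -/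
theorem exists_le_of_le_iSup {ι : Type*} {S : ι → Submodule k C}
    (hS : ∀ i, IsSimpleLeftCoideal k (S i)) (hind : iSupIndep S)
    (hiso : Pairwise fun i j => ¬ LeftComoduleIso (hS i).1 (hS j).1)
    (T : Submodule (DualAlg k C)ᵐᵒᵖ C) [IsSimpleModule (DualAlg k C)ᵐᵒᵖ T]
    (hT : T.restrictScalars k ≤ ⨆ i, S i) : ∃ i, ∀ x ∈ T, x ∈ S i := by
  obtain ⟨g, hg1, hg0, hfin⟩ := exists_projections (fun i => (hS i).1) hind
  have hsimple := fun i => (hS i).isSimpleModule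
  have hsum : ∀ x ∈ ⨆ i, S i, (∀ i, leftAct (g i) x ∈ S i) ∧ x = ∑ᶠ i, leftAct (g i) x := by
    intro x hx
    induction hx using Submodule.iSup_induction' with
    | mem j x hx =>
      refine ⟨fun i => ?_, ?_⟩
      · by_cases h : i = j
        · subst h
          rwa [hg1 i x hx]
        · rw [hg0 i j h x hx]
          exact zero_mem _
      · rw [finsum_eq_single _ j fun i hi => hg0 i j hi x hx, hg1 j x hx]
    | zero => simp
    | add x y _ _ hx hy =>
      refine ⟨fun i => by rw [map_add]; exact add_mem (hx.1 i) (hy.1 i), ?_⟩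
      simp only [map_add]
      rw [finsum_add_distrib (hfin x) (hfin y), ← hx.2, ← hy.2]
  let p : ∀ i, T →ₗ[(DualAlg k C)ᵐᵒᵖ] (hS i).1.toSubmodule := fun i =>
    ((leftActHom (g i)).domRestrict T).codRestrict _ fun x => (hsum x (hT x.2)).1 i
  have hp : ∀ i (x : T), (p i x : C) = leftAct (g i) x := fun _ _ => rfl
  have hbij : ∀ i, p i ≠ 0 → Function.Bijective (p i) := fun i hi =>
    LinearMap.bijective_of_ne_zero (R := (DualAlg k C)ᵐᵒᵖ) (M := T) (N := (hS i).1.toSubmodule) hi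
  -- By Schur, two nonzero components would identify two distinct summands through `T`.
  have hunique : ∀ i j, p i ≠ 0 → p j ≠ 0 → i = j := by
    intro i j hi hj
    by_contra hij
    refine hiso hij (leftComoduleIso_of_linearEquiv _ _ ?_)
    exact (LinearEquiv.ofBijective _ (hbij i hi)).symm.trans
      (LinearEquiv.ofBijective _ (hbij j hj))
  obtain ⟨i, hi⟩ : ∃ i, p i ≠ 0 := by
    by_contra! h
    refine (isSimpleModule_iff_isAtom.1 ‹IsSimpleModule _ T›).1 ((Submodule.eq_bot_iff _).2
      fun x hx => ?_)
    rw [(hsum x (hT hx)).2]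
    refine finsum_eq_zero_of_forall_eq_zero fun i => ?_
    rw [← hp i ⟨x, hx⟩, h i, LinearMap.zero_apply, Submodule.coe_zero]
  refine ⟨i, fun x hx => ?_⟩
  have h := hsum x (hT hx)
  rw [finsum_eq_single _ i fun j hj => ?_] at h
  · rw [h.2]
    exact h.1 i
  · have h0 : p j = 0 := by
      by_contra hj0
      exact hj (hunique j i hj0 hi)
    rw [← hp j ⟨x, hx⟩, h0, LinearMap.zero_apply, Submodule.coe_zero]

/-- A right linear map out of `C` is injective if it is nonzero on every simple left coideal of
a decomposition of the coradical into pairwise non-isomorphic ones. -/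
theorem injective_of_forall_ne_zero {ι : Type*} {S : ι → Submodule k C}
    (hS : ∀ i, IsSimpleLeftCoideal k (S i)) (hind : iSupIndep S)
    (hsup : ⨆ i, S i = coradical k C)
    (hiso : Pairwise fun i j => ¬ LeftComoduleIso (hS i).1 (hS j).1)
    {M : Type*} [AddCommGroup M] [Module (DualAlg k C)ᵐᵒᵖ M]
    (ψ : C →ₗ[(DualAlg k C)ᵐᵒᵖ] M) (hψ : ∀ i, ∃ x ∈ S i, ψ x ≠ 0) : Function.Injective ψ := by
  rw [← LinearMap.ker_eq_bot]
  by_contra hker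
  obtain ⟨T, hTker, hT⟩ := exists_isSimpleModule_le hker
  obtain ⟨i, hi⟩ := exists_le_of_le_iSup hS hind hiso T (hsup ▸ le_coradical T)
  have hatom := isSimpleModule_iff_isAtom.1 (hS i).isSimpleModule
  have heq : T = (hS i).1.toSubmodule :=
    (hatom.le_iff_eq (isSimpleModule_iff_isAtom.1 hT).1).1 hi
  obtain ⟨x, hx, hne⟩ := hψ i
  exact hne (hTker (heq ▸ hx : x ∈ T))

/-- A locally finite sum of right linear maps out of `C`. -/
noncomputable def finsumHom {ι M : Type*} [AddCommGroup M] [Module (DualAlg k C)ᵐᵒᵖ M]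
    (φ : ι → C →ₗ[(DualAlg k C)ᵐᵒᵖ] M) (h : ∀ c, {i | φ i c ≠ 0}.Finite) :
    C →ₗ[(DualAlg k C)ᵐᵒᵖ] M where
  toFun c := ∑ᶠ i, φ i c
  map_add' x y := by
    simp only [map_add]
    exact finsum_add_distrib (h x) (h y)
  map_smul' f x := by
    simp only [map_smul, RingHom.id_apply]
    exact (smul_finsum' f (h x)).symm

theorem finsumHom_apply {ι M : Type*} [AddCommGroup M] [Module (DualAlg k C)ᵐᵒᵖ M]
    (φ : ι → C →ₗ[(DualAlg k C)ᵐᵒᵖ] M) (h : ∀ c, {i | φ i c ≠ 0}.Finite) (c : C) :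
    finsumHom φ h c = ∑ᶠ i, φ i c := rfl

/-- The identity map from the opposite of a semiring to the semiring, as a map of right modules. -/
def unopRightLinear (A : Type*) [Semiring A] : Aᵐᵒᵖ →ₗ[Aᵐᵒᵖ] A where
  toFun := MulOpposite.unop
  map_add' _ _ := rfl
  map_smul' _ _ := rfl

theorem IsRightQuasiCoFrobenius.exists_ne_zero (h : IsRightQuasiCoFrobenius k C) {x : C}
    (hx : x ≠ 0) : ∃ φ : C →ₗ[(DualAlg k C)ᵐᵒᵖ] DualAlg k C, φ x ≠ 0 := by
  obtain ⟨F, _, _, _, φ, hφ⟩ := h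
  let b := Module.Free.chooseBasis (DualAlg k C)ᵐᵒᵖ F
  have hne : b.repr (φ x) ≠ 0 := by
    simpa using (map_ne_zero_iff φ hφ).2 hx
  obtain ⟨a, ha⟩ := Finsupp.ne_iff.1 hne
  refine ⟨unopRightLinear _ ∘ₗ Finsupp.lapply a ∘ₗ b.repr.toLinearMap ∘ₗ φ, fun h0 => ha ?_⟩
  exact MulOpposite.unop_injective h0

end Main

end CoalgQcF

open CoalgQcF in
theorem mainTheorem5 (k : Type u) (C : Type v) [Field k] [AddCommGroup C] [Module k C]
    [Coalgebra k C] (hq : CoalgQcF.IsRightQuasiCoFrobenius k C) (hb : CoalgQcF.IsBasic k C) :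
    CoalgQcF.IsRightCoFrobenius k C := by
  obtain ⟨ι, S, hS, hind, hsup, hiso⟩ := hb
  obtain ⟨g, hg1, hg0, hfin⟩ := exists_projections (fun i => (hS i).1) hind
  choose x hx hx0 using fun i => (S i).exists_mem_ne_zero_of_ne_bot (hS i).2.1
  choose φ hφ using fun i => hq.exists_ne_zero (hx0 i)
  refine ⟨finsumHom (fun i => φ i ∘ₗ leftActHom (g i)) fun c => ?_,
    injective_of_forall_ne_zero hS hind hsup hiso _ fun i => ⟨x i, hx i, ?_⟩⟩
  · refine (hfin c).subset fun i hi h0 => hi ?_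
    rw [LinearMap.comp_apply, leftActHom_apply, h0, map_zero]
  · rw [finsumHom_apply, finsum_eq_single _ i fun j hj => ?_]
    · rw [LinearMap.comp_apply, leftActHom_apply, hg1 i _ (hx i)]
      exact hφ i
    · rw [LinearMap.comp_apply, leftActHom_apply, hg0 j i hj _ (hx i), map_zero]
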